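/- **Corollary 3.2.** For $f\in L_2(\mathbb{R}^d)$ (complex-valued), an invertible real $d\times d$ matrix $U$ and $k\in\mathbb{Z}^d$ write $f_{U;k}(x):=|\det U|^{1/2}f(Ux-k)$. For $\Phi\subset L_2(\mathbb{R}^d)$ let $\mathbf{S}(\Phi)$ be the closure in $L_2(\mathbb{R}^d)$ of the linear span of $\{\phi(\cdot-k):\phi\in\Phi,\ k\in\mathbb{Z}^d\}$, and for a shift-invariant closed subspace $S$ let $\operatorname{len}(S):=\min\{\#\Phi: S=\mathbf{S}(\Phi)\}$. Let $\mathbf{M}$ be an invertible real $d\times d$ matrix. A countable set $\Psi\subset L_2(\mathbb{R}^d)$ is a *homogeneous $\mathbf{M}$-framelet* if there are constants $C_1,C_2>0$ such that $$C_1\|f\|^2\le\sum_{j\in\mathbb{Z}}\sum_{\psi\in\Psi}\sum_{k\in\mathbb{Z}^d}|\langle f,\psi_{\mathbf{M}^j;k}\rangle|^2\le C_2\|f\|^2\qquad\text{for all } f\in L_2(\mathbb{R}^d);$$ the optimal (largest, respectively smallest) such $C_1$ and $C_2$ are its lower and upper frame bounds. Let $\Psi\subset L_2(\mathbb{R}^d)$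 be a countable homogeneous $\mathbf{M}$-framelet with $s:=\operatorname{len}(\mathbf{S}(\Psi))<\infty$. Then there is a set $H=\{\eta^1,\dots,\eta^s\}\subset\mathbf{S}(\Psi)$ of exactly $s$ elements such that $\mathbf{S}(H)=\mathbf{S}(\Psi)$, $H$ is a homogeneous $\mathbf{M}$-framelet with the same lower and upper frame bounds as $\Psi$, and $$\sum_{\psi\in\Psi}\sum_{k\in\mathbb{Z}^d}|\langle f,\psi_{\mathbf{M}^j;k}\rangle|^2=\sum_{\ell=1}^{s}\sum_{k\in\mathbb{Z}^d}|\langle f,\eta^\ell_{\mathbf{M}^j;k}\rangle|^2\qquad\text{for all } f\in L_2(\mathbb{R}^d),\ j\in\mathbb{Z}.$$ -/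

import Mathlib

open MeasureTheory
open scoped ENNReal

noncomputable section

namespace Framelet

/-- The Euclidean space `ℝ^d`. -/
abbrev Rd (d : ℕ) : Type := EuclideanSpace ℝ (Fin d)

/-- The Hilbert space `L₂(ℝ^d)` of complex-valued functions, with respect to Lebesgue measure. -/
abbrev L2 (d : ℕ) : Type := Lp ℂ 2 (volume : Measure (Rd d))

/-- An integer vector `k ∈ ℤ^d` as a point of `ℝ^d`. -/
def latticePoint {d : ℕ} (k : Fin d → ℤ) : Rd d :=
  WithLp.toLp 2 (fun i => (k i : ℝ))

/-- The shift `f(· - k)` of `f ∈ L₂(ℝ^d)`, for `k ∈ ℤ^d`. -/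
def shift {d : ℕ} (k : Fin d → ℤ) (f : L2 d) : L2 d :=
  Lp.compMeasurePreserving (fun x : Rd d => x - latticePoint k)
    (measurePreserving_sub_right volume (latticePoint k)) f

/-- The function `x ↦ |det U|^{1/2} f(U x - k)`. -/
def affineFun {d : ℕ} (U : GL (Fin d) ℝ) (k : Fin d → ℤ) (f : Rd d → ℂ) : Rd d → ℂ :=
  fun x => (Real.sqrt |(U : Matrix (Fin d) (Fin d) ℝ).det| : ℂ) *
    f (Matrix.toEuclideanLin (U : Matrix (Fin d) (Fin d) ℝ) x - latticePoint k)

theorem memLp_affineFun {d : ℕ} (U : GL (Fin d) ℝ) (k : Fin d → ℤ) {f : Rd d → ℂ}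
    (hf : MemLp f 2 volume) : MemLp (affineFun U k f) 2 volume := by
  have hU : (U : Matrix (Fin d) (Fin d) ℝ).det ≠ 0 := U.det_ne_zero
  set L : Rd d →ₗ[ℝ] Rd d := Matrix.toEuclideanLin (U : Matrix (Fin d) (Fin d) ℝ) with hL
  have hdet : LinearMap.det L ≠ 0 := by
    have : LinearMap.det L = (U : Matrix (Fin d) (Fin d) ℝ).det := by
      rw [hL, Matrix.toEuclideanLin_eq_toLin]
      exact LinearMap.det_toLin _ _
    rwa [this]
  have hmap := Measure.map_linearMap_addHaar_eq_smul_addHaar (volume : Measure (Rd d)) hdet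
  have hLm : Measurable (L : Rd d → Rd d) := L.continuous_of_finiteDimensional.measurable
  have h1 : MemLp (fun y => f (y - latticePoint k)) 2 (volume : Measure (Rd d)) :=
    hf.comp_measurePreserving (measurePreserving_sub_right volume (latticePoint k))
  have h2 : MemLp (fun y => f (y - latticePoint k)) 2 (Measure.map L volume) := by
    rw [hmap]
    exact h1.smul_measure ENNReal.ofReal_ne_top
  exact (h2.comp_of_map hLm.aemeasurable).const_mul _

/-- `f_{U;k} = |det U|^{1/2} f(U · - k)` as an element of `L₂(ℝ^d)`. -/
def affine {d : ℕ} (U : GL (Fin d) ℝ) (k : Fin d → ℤ) (f : L2 d) : L2 d :=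
  (memLp_affineFun U k (Lp.memLp f)).toLp (affineFun U k f)

/-- `S(Φ)`, the shift-invariant space generated by `Φ`: the closure in `L₂(ℝ^d)` of the linear
span of all shifts `φ(· - k)`, `φ ∈ Φ`, `k ∈ ℤ^d`. -/
def shiftSpace {d : ℕ} (Φ : Set (L2 d)) : Submodule ℂ (L2 d) :=
  (Submodule.span ℂ {g | ∃ φ ∈ Φ, ∃ k : Fin d → ℤ, g = shift k φ}).topologicalClosure

/-- The length of a shift-invariant space: the least number of generators (`⊤` if there is no
finite set of generators). -/
def length {d : ℕ} (S : Submodule ℂ (L2 d)) : ℕ∞ :=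
  sInf {n | ∃ Φ : Set (L2 d), S = shiftSpace Φ ∧ Φ.encard = n}

/-- `∑_{ψ ∈ Ψ} ∑_{k ∈ ℤ^d} |⟨f, ψ_{M^j;k}⟩|²`, as an extended nonnegative number. -/
def levelSum {d : ℕ} (M : GL (Fin d) ℝ) (Ψ : Set (L2 d)) (j : ℤ) (f : L2 d) : ℝ≥0∞ :=
  ∑' (ψ : Ψ) (k : Fin d → ℤ), ‖inner ℂ (affine (M ^ j) k (ψ : L2 d)) f‖ₑ ^ 2

/-- `∑_{j ∈ ℤ} ∑_{ψ ∈ Ψ} ∑_{k ∈ ℤ^d} |⟨f, ψ_{M^j;k}⟩|²`. -/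
def frameSum {d : ℕ} (M : GL (Fin d) ℝ) (Ψ : Set (L2 d)) (f : L2 d) : ℝ≥0∞ :=
  ∑' j : ℤ, levelSum M Ψ j f

/-- `Ψ` is a homogeneous `M`-framelet: the homogeneous affine system generated by `Ψ` is a frame
of `L₂(ℝ^d)`. -/
def IsHomogeneousFramelet {d : ℕ} (M : GL (Fin d) ℝ) (Ψ : Set (L2 d)) : Prop :=
  ∃ C₁ C₂ : ℝ, 0 < C₁ ∧ 0 < C₂ ∧ ∀ f : L2 d,
    ENNReal.ofReal (C₁ * ‖f‖ ^ 2) ≤ frameSum M Ψ f ∧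
      frameSum M Ψ f ≤ ENNReal.ofReal (C₂ * ‖f‖ ^ 2)

/-- The lower frame bound: the optimal constant in the lower frame inequality. -/
def lowerFrameBound {d : ℕ} (M : GL (Fin d) ℝ) (Ψ : Set (L2 d)) : ℝ≥0∞ :=
  sSup {C | ∀ f : L2 d, C * ‖f‖ₑ ^ 2 ≤ frameSum M Ψ f}

/-- The upper frame bound: the optimal constant in the upper frame inequality. -/
def upperFrameBound {d : ℕ} (M : GL (Fin d) ℝ) (Ψ : Set (L2 d)) : ℝ≥0∞ :=
  sInf {C | ∀ f : L2 d, frameSum M Ψ f ≤ C * ‖f‖ₑ ^ 2}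

end Framelet

end

/-!
The sums at one dilation level are quadratic forms in shift coefficients: since dilation by `M ^ j`
is unitary, `⟨f, ψ_{M^j;k}⟩ = ⟨D f, ψ(· - k)⟩` with a dilation `D` depending on `j` only
(`Framelet.inner_affine`). It therefore suffices to find `s` functions whose shifts have the same
frame operator as the shifts of `Ψ`, which form a Bessel system because of the terms with `j = 0`.
Equality of the frame operators also gives equality of the generated shift-invariant spaces, because
the orthogonal complement of such a space is the zero set of the quadratic form; and `s` generators
of a space of length `s` are necessarily distinct.

The shift statement holds for any unitary representation `U` of an abelian group on a Hilbert space,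
and is proved in that generality without passing to Fourier fibers. Let `φ` be a finite family of
generators, as many as wanted, of the space `S` generated by the Bessel system `ψ`.

* `ShiftFrame.exists_isBessel`: the family `φ` need not be Bessel, so that its analysis operator `A`
  is unbounded. But `F = (1 + A†A)⁻¹` is an everywhere defined self-adjoint operator commuting
  with `U`, obtained from the orthogonal projection to the graph of `A`, and its range lies in the
  domain of `A`. The coefficients of `f` with respect to the family `F φ` are those of `F f` with
  respect to `φ`; so `F φ` is a Bessel family. It still generates `S`, because the domain of `A` is
  dense: it contains the orbits of `ψ` and the orthogonal complement of `S`.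
* `ShiftFrame.exists_coeff_eq_of_isBessel`: let now `A` be the bounded analysis operator of the new
  Bessel family, `A = V|A|` its polar decomposition and `C` the analysis operator of `ψ`. The operator
  `V|C|` intertwines `U` with the translation of coefficients, and is therefore the analysis operator
  of a family `η` with the same index set as `φ`; and `‖V|C| f‖ = ‖|C| f‖ = ‖C f‖`, since `V` is
  isometric on `S`, the closed range of `|A|`.
-/

noncomputable section

namespace ShiftFrame
open ContinuousLinearMap
open scoped InnerProductSpace

/-! ### Modulus and polar decomposition of a bounded operator -/

section Polar

variable {H K : Type*} [NormedAddCommGroup H] [InnerProductSpace ℂ H] [CompleteSpace H]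
  [NormedAddCommGroup K] [InnerProductSpace ℂ K] [CompleteSpace K]

/-- The modulus `(A†A)^{1/2}` of a bounded operator `A`. -/
def modulus (A : H →L[ℂ] K) : H →L[ℂ] H := CFC.sqrt (adjoint A ∘L A)

theorem modulus_isSelfAdjoint (A : H →L[ℂ] K) : IsSelfAdjoint (modulus A) :=
  (CFC.sqrt_nonneg _).isSelfAdjoint

theorem modulus_comp_modulus (A : H →L[ℂ] K) :
    modulus A * modulus A = adjoint A ∘L A :=
  CFC.sqrt_mul_sqrt_self _
    ((nonneg_iff_isPositive _).2 (ContinuousLinearMap.isPositive_adjoint_comp_self A))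

theorem inner_modulus_left (A : H →L[ℂ] K) (x y : H) :
    ⟪modulus A x, y⟫_ℂ = ⟪x, modulus A y⟫_ℂ := by
  rw [← adjoint_inner_right, (modulus_isSelfAdjoint A).adjoint_eq]

theorem norm_modulus_apply (A : H →L[ℂ] K) (x : H) : ‖modulus A x‖ = ‖A x‖ := by
  have h : ⟪modulus A x, modulus A x⟫_ℂ = ⟪A x, A x⟫_ℂ := by
    rw [inner_modulus_left, ← adjoint_inner_right]
    exact congrArg (fun T : H →L[ℂ] H => ⟪x, T x⟫_ℂ) (modulus_comp_modulus A)
  rw [inner_self_eq_norm_sq_to_K, inner_self_eq_norm_sq_to_K] at h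
  have h' : ‖modulus A x‖ ^ 2 = ‖A x‖ ^ 2 := by exact_mod_cast h
  exact (sq_eq_sq₀ (norm_nonneg _) (norm_nonneg _)).1 h'

theorem commute_modulus {A : H →L[ℂ] K} {T : H →L[ℂ] H} (h : Commute (adjoint A ∘L A) T) :
    Commute (modulus A) T :=
  h.cfcₙ_nnreal _

/-- The polar decomposition `A = V|A|`, with `V` isometric on the closed range of `|A|`: the map
`|A| x ↦ A x` is isometric, hence well defined, and extends by continuity. -/
theorem exists_polar (A : H →L[ℂ] K) :
    ∃ V : H →L[ℂ] K, (∀ x, V (modulus A x) = A x) ∧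
      ∀ y ∈ (modulus A).range.topologicalClosure, ‖V y‖ = ‖y‖ := by
  set S := (modulus A).range.topologicalClosure with hS
  have hmem : ∀ x, modulus A x ∈ S := fun x =>
    Submodule.le_topologicalClosure _ ⟨x, rfl⟩
  have : CompleteSpace S :=
    (Submodule.isClosed_topologicalClosure _).completeSpace_coe
  let e : H →L[ℂ] S := (modulus A).codRestrict S hmem
  have hdense : DenseRange (e : H →ₗ[ℂ] S) := by
    intro y
    rw [Metric.mem_closure_iff]
    intro ε hε
    have hy : (y : H) ∈ closure ((modulus A).range : Set H) := y.2
    obtain ⟨_, ⟨x, rfl⟩, hx⟩ := Metric.mem_closure_iff.1 hy ε hε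
    exact ⟨e x, ⟨x, rfl⟩, hx⟩
  have hnorm : ∀ x, ‖(A : H →ₗ[ℂ] K) x‖ ≤ 1 * ‖(e : H →ₗ[ℂ] S) x‖ := fun x => by
    rw [one_mul]; exact (norm_modulus_apply A x).ge
  let W : S →L[ℂ] K := (A : H →ₗ[ℂ] K).extendOfNorm (e : H →ₗ[ℂ] S)
  have hW : ∀ x, W (e x) = A x := fun x => LinearMap.extendOfNorm_eq hdense ⟨1, hnorm⟩ x
  have hWn : ∀ y, ‖W y‖ = ‖y‖ := fun y =>
    hdense.induction (P := fun y => ‖W y‖ = ‖y‖)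
      (by rintro _ ⟨x, rfl⟩; exact (congrArg _ (hW x)).trans (norm_modulus_apply A x).symm)
      (isClosed_eq (by fun_prop) (by fun_prop)) y
  have hproj : ∀ y (hy : y ∈ S), S.orthogonalProjectionOnto y = ⟨y, hy⟩ := fun y hy =>
    S.orthogonalProjectionOnto_mem_subspace_eq_self ⟨y, hy⟩
  refine ⟨W ∘L S.orthogonalProjectionOnto, fun x => ?_, fun y hy => ?_⟩
  · rw [ContinuousLinearMap.comp_apply, hproj _ (hmem x)]; exact hW x
  · rw [ContinuousLinearMap.comp_apply, hproj _ hy, hWn]; rfl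

end Polar

/-! ### Bessel systems of orbits and their analysis operators -/

section Rep

variable {H G ι κ : Type*} [NormedAddCommGroup H] [InnerProductSpace ℂ H] [CompleteSpace H]
  [AddCommGroup G]

/-- The coefficients `⟨U_g φ_i, f⟩` of `f` with respect to the orbits of a family `φ` of vectors
under a unitary representation `U`. -/
def coeff (U : AddChar G (unitary (H →L[ℂ] H))) (φ : ι → H) (f : H) : ι × G → ℂ :=
  fun p => ⟪(U p.2).1 (φ p.1), f⟫_ℂ

/-- The orbits of the family `φ` form a Bessel system. By the closed graph theorem, it is enough to
ask that all coefficient families be square summable, without a uniform bound. -/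
def IsBessel (U : AddChar G (unitary (H →L[ℂ] H))) (φ : ι → H) : Prop :=
  ∀ f, Memℓp (coeff U φ f) 2

variable (U : AddChar G (unitary (H →L[ℂ] H)))

theorem inner_rep_left (g : G) (x y : H) : ⟪(U g).1 x, y⟫_ℂ = ⟪x, (U (-g)).1 y⟫_ℂ := by
  rw [AddChar.map_neg_eq_inv]
  exact (adjoint_inner_right (U g).1 x y).symm

theorem rep_add_apply (g h : G) (x : H) : (U (g + h)).1 x = (U g).1 ((U h).1 x) := by
  rw [AddChar.map_add_eq_mul]; rfl

theorem rep_zero_apply (x : H) : (U 0).1 x = x := by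
  rw [AddChar.map_zero_eq_one]; rfl

theorem coeff_rep (φ : ι → H) (g : G) (f : H) (p : ι × G) :
    coeff U φ ((U g).1 f) p = coeff U φ f (p.1, p.2 - g) := by
  have h := inner_rep_left U (-g) ((U p.2).1 (φ p.1)) f
  rw [neg_neg, ← rep_add_apply, neg_add_eq_sub] at h
  exact h.symm

/-- The action `(i, k) ↦ (i, k - g)` of the group on the index set of the coefficients. -/
def shiftIndex (ι : Type*) (g : G) : ι × G ≃ ι × G :=
  (Equiv.refl ι).prodCongr (Equiv.subRight g)

theorem coeff_rep_eq_comp (φ : ι → H) (g : G) (f : H) :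
    coeff U φ ((U g).1 f) = coeff U φ f ∘ shiftIndex ι g :=
  funext fun p => coeff_rep U φ g f p

theorem memℓp_comp_injective {α β : Type*} {c : β → ℂ} (hc : Memℓp c 2) {e : α → β}
    (he : Function.Injective e) : Memℓp (c ∘ e) 2 := by
  have h2 : (0 : ℝ) < (2 : ℝ≥0∞).toReal := by norm_num
  exact (memℓp_gen_iff h2).2 (((memℓp_gen_iff h2).1 hc).comp_injective he)

theorem memℓp_coeff_rep {φ : ι → H} {f : H} (h : Memℓp (coeff U φ f) 2) (g : G) :
    Memℓp (coeff U φ ((U g).1 f)) 2 := by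
  rw [coeff_rep_eq_comp]
  exact memℓp_comp_injective h (shiftIndex ι g).injective

/-- The coefficient pairing `∑ ⟨a, b⟩` is invariant under the representation. -/
theorem tsum_inner_coeff_rep (φ : ι → H) (g : G) (a b : H) :
    ∑' p, ⟪coeff U φ ((U g).1 a) p, coeff U φ ((U g).1 b) p⟫_ℂ =
      ∑' p, ⟪coeff U φ a p, coeff U φ b p⟫_ℂ := by
  simp_rw [coeff_rep_eq_comp]
  exact (shiftIndex ι g).tsum_eq (fun p => ⟪coeff U φ a p, coeff U φ b p⟫_ℂ)

@[fun_prop]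
theorem continuous_coeff (φ : ι → H) (p : ι × G) : Continuous fun f => coeff U φ f p := by
  unfold coeff; fun_prop

variable {U}

/-- The analysis operator of a Bessel system; it is bounded by the closed graph theorem. -/
def analysis {φ : ι → H} (hφ : IsBessel U φ) : H →L[ℂ] lp (fun _ : ι × G => ℂ) 2 :=
  ContinuousLinearMap.ofSeqClosedGraph
    (g := { toFun := fun f => (⟨coeff U φ f, hφ f⟩ : lp (fun _ : ι × G => ℂ) 2)
            map_add' := fun x y => Subtype.ext (funext fun p => inner_add_right _ _ _)
            map_smul' := fun c x => Subtype.ext (funext fun p => inner_smul_right _ _ _) })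
    (by
      intro u x y hu hy
      ext p
      have h1 : Filter.Tendsto (fun n => coeff U φ (u n) p) Filter.atTop (nhds (coeff U φ x p)) :=
        ((continuous_coeff U φ p).tendsto x).comp hu
      have h2 := ((lp.evalCLM ℂ (fun _ : ι × G => ℂ) 2 p).continuous.tendsto y).comp hy
      exact tendsto_nhds_unique h2 h1)

theorem analysis_eq_zero_iff {φ : ι → H} (hφ : IsBessel U φ) (f : H) :
    analysis hφ f = 0 ↔ coeff U φ f = 0 :=
  ⟨fun h => congrArg Subtype.val h, fun h => Subtype.ext h⟩

theorem commute_adjoint_analysis {φ : ι → H} (hφ : IsBessel U φ) (g : G) :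
    Commute (adjoint (analysis hφ) ∘L analysis hφ) (U g).1 := by
  ext x
  refine ext_inner_left ℂ fun y => ?_
  change ⟪y, adjoint (analysis hφ) (analysis hφ ((U g).1 x))⟫_ℂ =
    ⟪y, (U g).1 (adjoint (analysis hφ) (analysis hφ x))⟫_ℂ
  have hy : ⟪y, (U g).1 (adjoint (analysis hφ) (analysis hφ x))⟫_ℂ =
      ⟪(U (-g)).1 y, adjoint (analysis hφ) (analysis hφ x)⟫_ℂ := by
    rw [inner_rep_left, neg_neg]
  rw [hy, adjoint_inner_right, adjoint_inner_right, lp.inner_eq_tsum, lp.inner_eq_tsum]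
  have := tsum_inner_coeff_rep U φ g ((U (-g)).1 y) x
  rw [← rep_add_apply, add_neg_cancel, rep_zero_apply] at this
  exact this

/-! ### Prescribing the frame operator -/

theorem tsum_enorm_sq_lp {α : Type*} (c : lp (fun _ : α => ℂ) 2) :
    ∑' p, ‖c p‖ₑ ^ 2 = ‖c‖ₑ ^ 2 := by
  have h := lp.hasSum_norm (p := 2) (by norm_num) c
  simp only [ENNReal.toReal_ofNat, Real.rpow_ofNat] at h
  have hterm : ∀ p, ‖c p‖ₑ ^ 2 = ENNReal.ofReal (‖c p‖ ^ 2) := fun p => by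
    rw [ENNReal.ofReal_pow (norm_nonneg _), ofReal_norm]
  simp_rw [hterm]
  rw [← ENNReal.ofReal_tsum_of_nonneg (fun _ => by positivity) h.summable, h.tsum_eq,
    ENNReal.ofReal_pow (norm_nonneg _), ofReal_norm]

/-- If the space generated by the orbits of `φ` contains that generated by the orbits of `ψ`, then
the frame operator of the second system is that of a system of orbits with the index set of `φ`. If
`A` and `C` are the analysis operators of `φ` and `ψ` and `A = V|A|` is the polar decomposition, then
`V|C|` is the analysis operator of the new system. -/
theorem exists_coeff_eq_of_isBessel {φ : ι → H} {ψ : κ → H} (hφ : IsBessel U φ)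
    (hψ : IsBessel U ψ) (hker : ∀ f, coeff U φ f = 0 → coeff U ψ f = 0) :
    ∃ η : ι → H, ∀ f, ∑' p, ‖coeff U η f p‖ₑ ^ 2 = ∑' q, ‖coeff U ψ f q‖ₑ ^ 2 := by
  obtain ⟨V, hVA, hV⟩ := exists_polar (analysis hφ)
  set A := analysis hφ with hA
  set C := analysis hψ with hC
  set S := (modulus A).range.topologicalClosure with hS
  have hQU : ∀ (g : G) x, modulus A ((U g).1 x) = (U g).1 (modulus A x) := fun g x =>
    congrArg (fun T : H →L[ℂ] H => T x) (commute_modulus (commute_adjoint_analysis hφ g)).eq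
  have hRU : ∀ (g : G) x, modulus C ((U g).1 x) = (U g).1 (modulus C x) := fun g x =>
    congrArg (fun T : H →L[ℂ] H => T x) (commute_modulus (commute_adjoint_analysis hψ g)).eq
  -- A vector orthogonal to the range of `|A|` is in the kernels of `A`, of `C` and of `|C|`.
  have hRS : ∀ f, modulus C f ∈ S := by
    intro f
    rw [hS, ← Submodule.orthogonal_orthogonal_eq_closure, Submodule.mem_orthogonal]
    intro y hy
    have hQy : modulus A y = 0 := by
      refine inner_self_eq_zero (𝕜 := ℂ).1 ?_
      rw [← inner_modulus_left]
      exact (Submodule.mem_orthogonal _ _).1 hy _ ⟨modulus A y, rfl⟩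
    have hAy : A y = 0 := by rw [← norm_eq_zero, ← norm_modulus_apply, hQy, norm_zero]
    have hCy : C y = 0 :=
      (analysis_eq_zero_iff hψ y).2 (hker y ((analysis_eq_zero_iff hφ y).1 hAy))
    have hRy : modulus C y = 0 := by rw [← norm_eq_zero, norm_modulus_apply, hCy, norm_zero]
    rw [← inner_modulus_left, hRy, inner_zero_left]
  -- `V` intertwines the representation with the translation of coefficients, first on the range of
  -- `|A|`, where `V|A| = A`, then on its closure.
  have hVU : ∀ (g : G), ∀ y ∈ S, ∀ p : ι × G, V ((U g).1 y) p = V y (p.1, p.2 - g) := by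
    intro g y hy p
    have hcl : IsClosed {y | V ((U g).1 y) p = V y (p.1, p.2 - g)} :=
      isClosed_eq
        ((lp.evalCLM ℂ (fun _ : ι × G => ℂ) 2 p).continuous.comp (by fun_prop))
        ((lp.evalCLM ℂ (fun _ : ι × G => ℂ) 2 (p.1, p.2 - g)).continuous.comp (by fun_prop))
    refine hcl.closure_subset_iff.2 ?_ hy
    rintro _ ⟨x, rfl⟩
    change V ((U g).1 (modulus A x)) p = V (modulus A x) (p.1, p.2 - g)
    rw [← hQU, hVA, hVA]
    exact coeff_rep U φ g x p
  let X : H →L[ℂ] lp (fun _ : ι × G => ℂ) 2 := V ∘L modulus C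
  have hX : ∀ (g : G) f i, X ((U (-g)).1 f) (i, 0) = X f (i, g) := by
    intro g f i
    change V (modulus C ((U (-g)).1 f)) (i, 0) = V (modulus C f) (i, g)
    rw [hRU, hVU _ _ (hRS f)]
    simp
  -- By equivariance, `X` is determined by its coordinates at `0 ∈ G`, and `η i` represents the
  -- functional `f ↦ X f (i, 0)`.
  refine ⟨fun i => (InnerProductSpace.toDual ℂ H).symm
    (lp.evalCLM ℂ (fun _ : ι × G => ℂ) 2 (i, 0) ∘L X), fun f => ?_⟩
  have hη : ∀ p, coeff U (fun i => (InnerProductSpace.toDual ℂ H).symm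
      (lp.evalCLM ℂ (fun _ : ι × G => ℂ) 2 (i, 0) ∘L X)) f p = X f p := by
    intro p
    rw [coeff, inner_rep_left, InnerProductSpace.toDual_symm_apply]
    exact hX p.2 f p.1
  have hnorm : ‖X f‖ₑ = ‖C f‖ₑ := by
    rw [← ofReal_norm, ← ofReal_norm, ← norm_modulus_apply C f]
    exact congrArg ENNReal.ofReal (hV _ (hRS f))
  simp_rw [hη]
  rw [tsum_enorm_sq_lp, hnorm, ← tsum_enorm_sq_lp]
  rfl

/-! ### Replacing generators by Bessel generators -/

/-- The graph of the (in general unbounded) analysis operator of a family `φ`, as a subspace of the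
Hilbert sum of `H` and the coefficient space. -/
def analysisGraph (U : AddChar G (unitary (H →L[ℂ] H))) (φ : ι → H) :
    Submodule ℂ (WithLp 2 (H × lp (fun _ : ι × G => ℂ) 2)) where
  carrier := {x | ∀ p, x.snd p = coeff U φ x.fst p}
  add_mem' hx hy p :=
    (congrArg₂ (· + ·) (hx p) (hy p)).trans (inner_add_right _ _ _).symm
  zero_mem' _ := (inner_zero_right _).symm
  smul_mem' c _ hx p := (congrArg (c • ·) (hx p)).trans (inner_smul_right _ _ _).symm

theorem isClosed_analysisGraph (φ : ι → H) :
    IsClosed (analysisGraph U φ : Set (WithLp 2 (H × lp (fun _ : ι × G => ℂ) 2))) := by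
  have : (analysisGraph U φ : Set (WithLp 2 (H × lp (fun _ : ι × G => ℂ) 2))) =
      ⋂ p, {x | x.snd p = coeff U φ x.fst p} := by
    ext x; simp [analysisGraph]
  rw [this]
  refine isClosed_iInter fun p => isClosed_eq ?_ ?_
  · exact (lp.evalCLM ℂ (fun _ : ι × G => ℂ) 2 p).continuous.comp (WithLp.continuous_snd _ _ _)
  · exact (continuous_coeff U φ p).comp (WithLp.continuous_fst _ _ _)

/-- `f` solves `(1 + A†A) f = y` weakly, `A` being the analysis operator of `φ` on its maximal
domain. -/
def IsResolvent (U : AddChar G (unitary (H →L[ℂ] H))) (φ : ι → H) (y f : H) : Prop :=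
  Memℓp (coeff U φ f) 2 ∧ ∀ g, Memℓp (coeff U φ g) 2 →
    ⟪f, g⟫_ℂ + ∑' p, ⟪coeff U φ f p, coeff U φ g p⟫_ℂ = ⟪y, g⟫_ℂ

/-- A solution is the first component of the projection of `(y, 0)` to the graph of the analysis
operator. -/
theorem exists_isResolvent (φ : ι → H) (y : H) : ∃ f, IsResolvent U φ y f := by
  have : CompleteSpace (analysisGraph U φ) := (isClosed_analysisGraph φ).completeSpace_coe
  let x : WithLp 2 (H × lp (fun _ : ι × G => ℂ) 2) := WithLp.toLp 2 (y, 0)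
  obtain ⟨v, hv, hxv⟩ := (Submodule.HasOrthogonalProjection.exists_orthogonal
    (K := analysisGraph U φ) x)
  have hv2 : (v.snd : ι × G → ℂ) = coeff U φ v.fst := funext hv
  refine ⟨v.fst, hv2 ▸ lp.memℓp v.snd, fun g hg => ?_⟩
  have h := (Submodule.mem_orthogonal' _ _).1 hxv (WithLp.toLp 2 (g, ⟨coeff U φ g, hg⟩))
    (fun p => rfl)
  rw [inner_sub_left, sub_eq_zero, WithLp.prod_inner_apply, WithLp.prod_inner_apply] at h
  have h0 : ⟪x.snd, (⟨coeff U φ g, hg⟩ : lp (fun _ : ι × G => ℂ) 2)⟫_ℂ = 0 := inner_zero_left _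
  have h1 : ⟪v.snd, (⟨coeff U φ g, hg⟩ : lp (fun _ : ι × G => ℂ) 2)⟫_ℂ =
      ∑' p, ⟪coeff U φ v.fst p, coeff U φ g p⟫_ℂ := by
    rw [lp.inner_eq_tsum, ← hv2]
  rw [← h1]
  exact h.symm.trans ((congrArg _ h0).trans (add_zero _))

/-- The resolvent is self-adjoint. -/
theorem IsResolvent.symm {φ : ι → H} {y₁ y₂ f₁ f₂ : H} (h₁ : IsResolvent U φ y₁ f₁)
    (h₂ : IsResolvent U φ y₂ f₂) : ⟪f₁, y₂⟫_ℂ = ⟪y₁, f₂⟫_ℂ := by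
  rw [← h₁.2 f₂ h₂.1, ← inner_conj_symm f₁ y₂, ← h₂.2 f₁ h₁.1, map_add, inner_conj_symm,
    Complex.conj_tsum]
  simp_rw [inner_conj_symm]

theorem IsResolvent.unique {φ : ι → H} {y f₁ f₂ : H} (h₁ : IsResolvent U φ y f₁)
    (h₂ : IsResolvent U φ y f₂) : f₁ = f₂ := by
  -- Both solutions represent the same functional, since every vector has a solution.
  refine ext_inner_right ℂ fun z => ?_
  obtain ⟨f, hf⟩ := exists_isResolvent (U := U) φ z
  rw [h₁.symm hf, h₂.symm hf]

/-- The resolvent commutes with the representation. -/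
theorem IsResolvent.rep {φ : ι → H} {y f : H} (h : IsResolvent U φ y f) (k : G) :
    IsResolvent U φ ((U k).1 y) ((U k).1 f) := by
  refine ⟨memℓp_coeff_rep U h.1 k, fun g hg => ?_⟩
  have hg' := h.2 _ (memℓp_coeff_rep U hg (-k))
  rw [← tsum_inner_coeff_rep U φ k, ← rep_add_apply, add_neg_cancel, rep_zero_apply] at hg'
  rw [inner_rep_left, inner_rep_left]
  exact hg'

/-- The orbits of a Bessel system `ψ` lie in the domain of the analysis operator of any finite family
`φ`, because `⟨U_k φ_i, ψ_q⟩` is up to conjugation a coefficient of `φ_i` with respect to `ψ`. -/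
theorem memℓp_coeff_orbit [Finite ι] (φ : ι → H) {ψ : κ → H} (hψ : IsBessel U ψ) (q : κ × G) :
    Memℓp (coeff U φ ((U q.2).1 (ψ q.1))) 2 := by
  refine memℓp_coeff_rep U ?_ _
  have h2 : (0 : ℝ) < (2 : ℝ≥0∞).toReal := by norm_num
  refine (memℓp_gen_iff h2).2 ?_
  refine (summable_prod_of_nonneg fun _ => by positivity).2 ⟨fun i => ?_, Summable.of_finite⟩
  have hinj : Function.Injective fun k : G => ((q.1, -k) : κ × G) := fun a b h => by
    simpa using h
  have := (memℓp_gen_iff h2).1 (memℓp_comp_injective (hψ (φ i)) hinj)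
  refine this.congr fun k => ?_
  have : ‖coeff U φ (ψ q.1) (i, k)‖ = ‖coeff U ψ (φ i) (q.1, -k)‖ := by
    rw [coeff, coeff, inner_rep_left, norm_inner_symm]
  exact congrArg (· ^ (2 : ℝ≥0∞).toReal) this.symm

/-- Finitely many generators of a space that also has a Bessel system of generators may be replaced
by as many Bessel generators: apply `(1 + A†A)⁻¹`, with `A` the analysis operator of `φ`. -/
theorem exists_isBessel [Finite ι] (φ : ι → H) {ψ : κ → H} (hψ : IsBessel U ψ)
    (hker : ∀ f, coeff U φ f = 0 ↔ coeff U ψ f = 0) :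
    ∃ φ' : ι → H, IsBessel U φ' ∧ ∀ f, coeff U φ' f = 0 → coeff U ψ f = 0 := by
  choose F hF using exists_isResolvent (U := U) φ
  have hcoeff : ∀ f, coeff U (F ∘ φ) f = coeff U φ (F f) := fun f => funext fun p =>
    ((hF _).rep p.2).symm (hF f)
  refine ⟨F ∘ φ, fun f => hcoeff f ▸ (hF f).1, fun f hf => ?_⟩
  rw [hcoeff] at hf
  -- If `A F f = 0`, the equation `(1 + A†A) F f = f` says that `F f - f` is orthogonal to the domain
  -- of `A`.
  have horth : ∀ g, Memℓp (coeff U φ g) 2 → ⟪F f - f, g⟫_ℂ = 0 := fun g hg => by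
    have := (hF f).2 g hg
    rw [inner_sub_left, ← this, hf]
    simp
  have hψ0 : coeff U ψ (F f - f) = 0 := funext fun q => by
    have := horth _ (memℓp_coeff_orbit φ hψ q)
    rw [coeff, ← inner_conj_symm, this, map_zero]; rfl
  have hφ0 := (hker _).2 hψ0
  have hzero : F f - f = 0 := by
    have := horth (F f - f) (by rw [hφ0]; exact zero_memℓp)
    exact inner_self_eq_zero.1 this
  rw [sub_eq_zero.1 hzero] at hf
  exact (hker f).1 hf

end Rep
end ShiftFrame

namespace Framelet
open ShiftFrame
open scoped InnerProductSpace ComplexConjugate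

variable {d : ℕ}

/-! ### The shift representation of `ℤ^d` on `L₂(ℝ^d)` -/

theorem shift_coeFn (k : Fin d → ℤ) (f : L2 d) :
    shift k f =ᵐ[volume] fun x => f (x - latticePoint k) :=
  Lp.coeFn_compMeasurePreserving f (measurePreserving_sub_right volume (latticePoint k))

theorem latticePoint_zero : latticePoint (0 : Fin d → ℤ) = 0 := by
  ext i; simp [latticePoint]

theorem latticePoint_add (k l : Fin d → ℤ) :
    latticePoint (k + l) = latticePoint k + latticePoint l := by
  ext i; simp [latticePoint]

theorem shift_zero (f : L2 d) : shift 0 f = f := by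
  refine Lp.ext ((shift_coeFn 0 f).trans ?_)
  simp [latticePoint_zero]

theorem shift_add (k l : Fin d → ℤ) (f : L2 d) : shift (k + l) f = shift k (shift l f) := by
  refine Lp.ext ((shift_coeFn _ f).trans ?_)
  have h := (measurePreserving_sub_right volume (latticePoint k)).quasiMeasurePreserving.ae_eq_comp
    (shift_coeFn l f)
  filter_upwards [shift_coeFn k (shift l f), h] with x hx hx'
  rw [hx, latticePoint_add, ← sub_sub]
  exact hx'.symm

/-- The shift as a unitary operator. -/
def shiftEquiv (k : Fin d → ℤ) : L2 d ≃ₗᵢ[ℂ] L2 d :=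
  { Lp.compMeasurePreservingₗᵢ ℂ (fun x : Rd d => x - latticePoint k)
      (measurePreserving_sub_right volume (latticePoint k)) with
    invFun := shift (-k)
    left_inv := fun f => by
      change shift (-k) (shift k f) = f
      rw [← shift_add, neg_add_cancel, shift_zero]
    right_inv := fun f => by
      change shift k (shift (-k) f) = f
      rw [← shift_add, add_neg_cancel, shift_zero] }

/-- The unitary representation of `ℤ^d` on `L₂(ℝ^d)` by shifts. -/
def shiftRep (d : ℕ) : AddChar (Fin d → ℤ) (unitary (L2 d →L[ℂ] L2 d)) where
  toFun k := Unitary.linearIsometryEquiv.symm (shiftEquiv k)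
  map_zero_eq_one' := by
    rw [EmbeddingLike.map_eq_one_iff]
    exact LinearIsometryEquiv.ext shift_zero
  map_add_eq_mul' k l := by
    rw [← map_mul]
    exact congrArg _ (LinearIsometryEquiv.ext (shift_add k l))

theorem coeff_shiftRep {ι : Type*} (φ : ι → L2 d) (f : L2 d) (p : ι × (Fin d → ℤ)) :
    coeff (shiftRep d) φ f p = ⟪shift p.2 (φ p.1), f⟫_ℂ := rfl

/-- Shift-invariant spaces are compared through their orthogonal complements, which are given by the
vanishing of coefficients. -/
theorem mem_orthogonal_shiftSpace_range {ι : Type*} (φ : ι → L2 d) (f : L2 d) :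
    f ∈ (shiftSpace (Set.range φ))ᗮ ↔ coeff (shiftRep d) φ f = 0 := by
  rw [shiftSpace, Submodule.orthogonal_closure]
  constructor
  · intro h
    funext p
    exact (Submodule.mem_orthogonal _ _).1 h _
      (Submodule.subset_span ⟨φ p.1, ⟨p.1, rfl⟩, p.2, rfl⟩)
  · intro h
    refine (Submodule.mem_orthogonal _ _).2 fun u hu => ?_
    induction hu using Submodule.span_induction with
    | mem u hu =>
      obtain ⟨_, ⟨i, rfl⟩, k, rfl⟩ := hu
      exact congrFun h (i, k)
    | zero => exact inner_zero_left _
    | add x y _ _ hx hy => rw [inner_add_left, hx, hy, add_zero]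
    | smul c x _ hx => rw [inner_smul_left, hx, mul_zero]

theorem shiftSpace_range_eq_iff {ι κ : Type*} (φ : ι → L2 d) (ψ : κ → L2 d) :
    shiftSpace (Set.range φ) = shiftSpace (Set.range ψ) ↔
      ∀ f, coeff (shiftRep d) φ f = 0 ↔ coeff (shiftRep d) ψ f = 0 := by
  simp_rw [← mem_orthogonal_shiftSpace_range]
  refine ⟨fun h f => by rw [h], fun h => ?_⟩
  have h' := congrArg Submodule.orthogonal (Submodule.ext h)
  rw [Submodule.orthogonal_orthogonal_eq_closure, Submodule.orthogonal_orthogonal_eq_closure] at h'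
  rwa [shiftSpace, shiftSpace, IsClosed.submodule_topologicalClosure_eq
    (Submodule.isClosed_topologicalClosure _), IsClosed.submodule_topologicalClosure_eq
    (Submodule.isClosed_topologicalClosure _)] at h'

theorem subset_shiftSpace (Φ : Set (L2 d)) : Φ ⊆ shiftSpace Φ := fun φ hφ =>
  Submodule.le_topologicalClosure _ (Submodule.subset_span ⟨φ, hφ, 0, (shift_zero φ).symm⟩)

/-! ### Reduction of a dilation level to shifts -/

theorem affine_coeFn (U : GL (Fin d) ℝ) (k : Fin d → ℤ) (f : L2 d) :
    affine U k f =ᵐ[volume] affineFun U k f :=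
  MemLp.coeFn_toLp _

theorem toEuclideanLin_inv_apply (U : GL (Fin d) ℝ) (x : Rd d) :
    Matrix.toEuclideanLin (U⁻¹ : GL (Fin d) ℝ).1 (Matrix.toEuclideanLin U.1 x) = x := by
  simp [Matrix.toLpLin_apply]

theorem integral_comp_toEuclideanLin (U : GL (Fin d) ℝ) (h : Rd d → ℂ) :
    ∫ x, h (Matrix.toEuclideanLin U.1 x) = |U.1.det|⁻¹ • ∫ x, h x := by
  have hinj : Function.Injective (Matrix.toEuclideanLin U.1) :=
    Function.LeftInverse.injective (toEuclideanLin_inv_apply U)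
  have hdet : LinearMap.det (Matrix.toEuclideanLin U.1) = U.1.det := by
    exact LinearMap.det_toLin (PiLp.basisFun 2 ℝ (Fin d)) U.1
  have hmap := Measure.map_linearMap_addHaar_eq_smul_addHaar (volume : Measure (Rd d))
    (f := Matrix.toEuclideanLin U.1) (hdet ▸ U.det_ne_zero)
  have hemb : MeasurableEmbedding (Matrix.toEuclideanLin U.1) :=
    (LinearMap.continuous_of_finiteDimensional _).measurableEmbedding hinj
  rw [← hemb.integral_map, hmap, integral_smul_measure, hdet, abs_inv,
    ENNReal.toReal_ofReal (by positivity)]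

/-- Dilation is unitary: the coefficients of `f` at a given dilation level are the shift
coefficients of a dilate of `f`. -/
theorem inner_affine (U : GL (Fin d) ℝ) (k : Fin d → ℤ) (ψ f : L2 d) :
    ⟪affine U k ψ, f⟫_ℂ = ⟪shift k ψ, affine U⁻¹ 0 f⟫_ℂ := by
  set a : ℝ := |U.1.det| with ha
  have ha0 : 0 < a := abs_pos.2 U.det_ne_zero
  have hinv : |(U⁻¹ : GL (Fin d) ℝ).1.det| = a⁻¹ := by
    rw [ha, ← abs_inv]
    simp [Matrix.coe_units_inv, Matrix.det_nonsing_inv]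
  let h : Rd d → ℂ := fun y => f (Matrix.toEuclideanLin (U⁻¹ : GL (Fin d) ℝ).1 y) *
    conj (ψ (y - latticePoint k))
  have hl : ⟪affine U k ψ, f⟫_ℂ = (Real.sqrt a : ℂ) * ∫ x, h (Matrix.toEuclideanLin U.1 x) := by
    rw [L2.inner_def, ← integral_const_mul]
    refine integral_congr_ae ?_
    filter_upwards [affine_coeFn U k ψ] with x hx
    simp only [h, toEuclideanLin_inv_apply, hx, affineFun, RCLike.inner_apply, map_mul,
      Complex.conj_ofReal, ← ha]
    ring
  have hr : ⟪shift k ψ, affine U⁻¹ 0 f⟫_ℂ = (Real.sqrt a⁻¹ : ℂ) * ∫ x, h x := by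
    rw [L2.inner_def, ← integral_const_mul]
    refine integral_congr_ae ?_
    filter_upwards [affine_coeFn U⁻¹ 0 f, shift_coeFn k ψ] with x hx hx'
    simp only [h, hx, hx', affineFun, RCLike.inner_apply, latticePoint_zero, sub_zero, hinv]
    ring
  rw [hl, hr, integral_comp_toEuclideanLin, ← ha, Complex.real_smul, ← mul_assoc]
  congr 1
  rw [← Complex.ofReal_mul, Real.sqrt_inv]
  congr 1
  have hs : Real.sqrt a ≠ 0 := (Real.sqrt_pos.2 ha0).ne'
  field_simp
  rw [Real.sq_sqrt ha0.le]

theorem affine_one_zero (f : L2 d) : affine 1 0 f = f := by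
  refine Lp.ext ((affine_coeFn _ _ _).trans ?_)
  refine .of_eq (funext fun x => ?_)
  simp [affineFun, latticePoint_zero]

theorem tsum_enorm_coeff_shiftRep {ι : Type*} (φ : ι → L2 d) (M : GL (Fin d) ℝ) (j : ℤ) (f : L2 d) :
    ∑' p, ‖coeff (shiftRep d) φ (affine (M ^ j)⁻¹ 0 f) p‖ₑ ^ 2 =
      ∑' (i : ι) (k : Fin d → ℤ), ‖inner ℂ (affine (M ^ j) k (φ i)) f‖ₑ ^ 2 := by
  rw [ENNReal.tsum_prod']
  simp_rw [inner_affine, coeff_shiftRep]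

theorem levelSum_range {ι : Type*} {φ : ι → L2 d} (hφ : Function.Injective φ) (M : GL (Fin d) ℝ)
    (j : ℤ) (f : L2 d) :
    levelSum M (Set.range φ) j f =
      ∑' p, ‖coeff (shiftRep d) φ (affine (M ^ j)⁻¹ 0 f) p‖ₑ ^ 2 := by
  rw [tsum_enorm_coeff_shiftRep, levelSum]
  exact ((Equiv.ofInjective φ hφ).tsum_eq _).symm

/-- The level `j = 0` of the upper frame inequality. -/
theorem IsHomogeneousFramelet.isBessel {M : GL (Fin d) ℝ} {Ψ : Set (L2 d)}
    (h : IsHomogeneousFramelet M Ψ) :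
    IsBessel (shiftRep d) (Subtype.val : Ψ → L2 d) := by
  obtain ⟨_, C, -, -, hC⟩ := h
  intro f
  have hle : levelSum M Ψ 0 f ≤ ENNReal.ofReal (C * ‖f‖ ^ 2) :=
    (ENNReal.le_tsum 0).trans (hC f).2
  have hsum := levelSum_range (φ := (Subtype.val : Ψ → L2 d)) Subtype.val_injective M 0 f
  rw [Subtype.range_coe, zpow_zero, inv_one, affine_one_zero] at hsum
  rw [hsum] at hle
  have h2 : (0 : ℝ) < (2 : ℝ≥0∞).toReal := by norm_num
  refine (memℓp_gen_iff h2).2 ?_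
  have hs := ENNReal.summable_toReal (ne_top_of_le_ne_top ENNReal.ofReal_ne_top hle)
  simpa using hs

/-! ### Generators of a space of finite length -/

theorem exists_encard_eq_length {S : Submodule ℂ (L2 d)} {s : ℕ} (hs : length S = s) :
    ∃ Φ : Set (L2 d), S = shiftSpace Φ ∧ Φ.encard = s := by
  have hne : {n | ∃ Φ : Set (L2 d), S = shiftSpace Φ ∧ Φ.encard = n}.Nonempty := by
    by_contra hempty
    rw [length, Set.not_nonempty_iff_eq_empty.1 hempty, sInf_empty] at hs
    exact ENat.top_ne_natCast s hs
  rw [← hs]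
  exact csInf_mem hne

theorem length_le_encard (Φ : Set (L2 d)) : length (shiftSpace Φ) ≤ Φ.encard :=
  sInf_le ⟨Φ, rfl, rfl⟩

/-- A Bessel system of shifts that generates a space of length `s` has the same frame operator as the
shifts of some `s` distinct functions. -/
theorem exists_generators_same_frame {Ψ : Set (L2 d)}
    (hΨ : IsBessel (shiftRep d) (Subtype.val : Ψ → L2 d)) {s : ℕ}
    (hs : length (shiftSpace Ψ) = s) :
    ∃ η : Fin s → L2 d, Function.Injective η ∧
      shiftSpace (Set.range η) = shiftSpace Ψ ∧
      ∀ f, ∑' p, ‖coeff (shiftRep d) (Subtype.val : Ψ → L2 d) f p‖ₑ ^ 2 =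
        ∑' p, ‖coeff (shiftRep d) η f p‖ₑ ^ 2 := by
  obtain ⟨Φ, hΦ, hcard⟩ := exists_encard_eq_length hs
  have hfin : Φ.Finite := Set.finite_of_encard_eq_coe hcard
  have : Finite Φ := hfin
  have hnat : Nat.card Φ = s := by
    rw [Nat.card_coe_set_eq, Set.ncard_def, hcard]; rfl
  let φ : Fin s → L2 d := fun i => ((Finite.equivFinOfCardEq hnat).symm i : L2 d)
  have hφ : Set.range φ = Φ := by
    rw [show φ = Subtype.val ∘ (Finite.equivFinOfCardEq hnat).symm from rfl,
      EquivLike.range_comp, Subtype.range_coe]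
  have hker : ∀ f, coeff (shiftRep d) φ f = 0 ↔
      coeff (shiftRep d) (Subtype.val : Ψ → L2 d) f = 0 := by
    rw [← shiftSpace_range_eq_iff, hφ, Subtype.range_coe, hΦ]
  obtain ⟨φ', hφ', hker'⟩ := exists_isBessel φ hΨ hker
  obtain ⟨η, hη⟩ := exists_coeff_eq_of_isBessel hφ' hΨ hker'
  have hzero : ∀ {ι : Type _} (c : ι → ℂ), c = 0 ↔ ∑' p, ‖c p‖ₑ ^ 2 = 0 := fun c => by
    simp [ENNReal.tsum_eq_zero, funext_iff]
  have hspace : shiftSpace (Set.range η) = shiftSpace Ψ := by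
    conv_rhs => rw [← Subtype.range_coe (s := Ψ)]
    rw [shiftSpace_range_eq_iff]
    intro f
    rw [hzero, hη, ← hzero]
  refine ⟨η, ?_, hspace, fun f => (hη f).symm⟩
  -- A repetition among the `η i` would give fewer than `s` generators.
  have hle : (s : ℕ∞) ≤ (Set.range η).encard := by
    rw [← hs, ← hspace]; exact length_le_encard _
  rw [← (Set.finite_range η).cast_ncard_eq, Nat.cast_le, ← Set.image_univ] at hle
  have hge := Set.ncard_image_le (f := η) (s := Set.univ)
  rw [Set.ncard_univ, Nat.card_fin] at hge
  refine Set.injOn_univ.1 (Set.injOn_of_ncard_image_eq ?_)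
  rw [Set.ncard_univ, Nat.card_fin]
  exact hge.antisymm hle

end Framelet

end

theorem corollary3p2 (d : ℕ) (M : GL (Fin d) ℝ) (Ψ : Set (Framelet.L2 d)) (hΨ : Ψ.Countable)
    (s : ℕ) (hs : Framelet.length (Framelet.shiftSpace Ψ) = s)
    (hframe : Framelet.IsHomogeneousFramelet M Ψ) :
    ∃ H : Set (Framelet.L2 d),
      H ⊆ (Framelet.shiftSpace Ψ : Set (Framelet.L2 d)) ∧
      H.encard = s ∧
      Framelet.shiftSpace H = Framelet.shiftSpace Ψ ∧
      Framelet.IsHomogeneousFramelet M H ∧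
      Framelet.lowerFrameBound M H = Framelet.lowerFrameBound M Ψ ∧
      Framelet.upperFrameBound M H = Framelet.upperFrameBound M Ψ ∧
      ∀ (f : Framelet.L2 d) (j : ℤ),
        Framelet.levelSum M Ψ j f = Framelet.levelSum M H j f := by
  obtain ⟨η, hinj, hspace, hη⟩ := Framelet.exists_generators_same_frame hframe.isBessel hs
  have hlevel : ∀ f j, Framelet.levelSum M Ψ j f = Framelet.levelSum M (Set.range η) j f := by
    intro f j
    rw [Framelet.levelSum_range hinj, ← hη,
      ← Framelet.levelSum_range (Subtype.val_injective (p := (· ∈ Ψ))), Subtype.range_coe]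
  have hsum : Framelet.frameSum M (Set.range η) = Framelet.frameSum M Ψ :=
    funext fun f => tsum_congr fun j => (hlevel f j).symm
  refine ⟨Set.range η, hspace ▸ Framelet.subset_shiftSpace _, ?_, hspace, ?_, ?_, ?_, hlevel⟩
  · rw [← Set.image_univ, hinj.encard_image, Set.encard_univ, ENat.card_eq_coe_fintype_card,
      Fintype.card_fin]
  · rwa [Framelet.IsHomogeneousFramelet, hsum]
  · rw [Framelet.lowerFrameBound, hsum, Framelet.lowerFrameBound]
  · rw [Framelet.upperFrameBound, hsum, Framelet.upperFrameBound]
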